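/- Let $k\ge 3$ be an integer. There exist a constant $c=c(k)>0$ and an integer $n_0=n_0(k)$ such that the following holds for every $n\ge n_0$. For a finite graph $G$, let $q(G)$ denote the largest eigenvalue of the signless Laplacian matrix $Q(G)=D(G)+A(G)$, where $D(G)$ is the diagonal matrix of vertex degrees and $A(G)$ is the adjacency matrix; let $T_{n,k}$ be the $k$-partite Turán graph on $n$ vertices (the complete $k$-partite graph whose part sizes differ by at most one); and let $js_{k+1}(G)$ be the maximum size of a $(k+1)$-joint of $G$, that is, the maximum, over the edges $e$ of $G$, of the number of copies of $K_{k+1}$ in $G$ that contain $e$ (and $0$ if $G$ has no edge). If $G$ is an $n$-vertex graph with $$q(G)\ge q(T_{n,k})$$ and $G$ is not isomorphic to $T_{n,k}$, then $$js_{k+1}(G)\ge c\,n^{k-1}.$$ -/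

import Mathlib

namespace SimpleGraph

/-- The signless Laplacian matrix `Q(G) = D(G) + A(G)` of a finite graph, over `ℝ`. -/
def signlessLapMatrix {V : Type*} [Fintype V] [DecidableEq V] (G : SimpleGraph V)
    [DecidableRel G.Adj] : Matrix V V ℝ :=
  G.degMatrix ℝ + G.adjMatrix ℝ

/-- The `Q`-index `q(G)`: the largest eigenvalue of the signless Laplacian matrix. -/
noncomputable def qIndex {V : Type*} [Fintype V] [DecidableEq V] (G : SimpleGraph V)
    [DecidableRel G.Adj] : ℝ :=
  sSup (spectrum ℝ G.signlessLapMatrix)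

theorem isHermitian_signlessLapMatrix {V : Type*} [Fintype V] [DecidableEq V]
    (G : SimpleGraph V) [DecidableRel G.Adj] : G.signlessLapMatrix.IsHermitian :=
  (G.isHermitian_degMatrix ℝ).add (G.isHermitian_adjMatrix ℝ)

/-- On a nonempty vertex set the supremum defining `q(G)` is attained: `q(G)` really is the
largest eigenvalue. -/
theorem isGreatest_qIndex {V : Type*} [Fintype V] [DecidableEq V] [Nonempty V]
    (G : SimpleGraph V) [DecidableRel G.Adj] :
    IsGreatest (spectrum ℝ G.signlessLapMatrix) G.qIndex := by
  have h := G.isHermitian_signlessLapMatrix.spectrum_real_eq_range_eigenvalues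
  have hf : (spectrum ℝ G.signlessLapMatrix).Finite := by
    rw [h]; exact Set.finite_range _
  have hn : (spectrum ℝ G.signlessLapMatrix).Nonempty := by
    rw [h]; exact Set.range_nonempty _
  exact ⟨hn.csSup_mem hf, fun _ hx => le_csSup hf.bddAbove hx⟩

/-- A finite collection `F` of vertex sets is an `r`-joint of `G` if its members are cliques
of order `r` of `G` that all contain a common edge of `G`; its size is the number of its
members. -/
def IsJoint {V : Type*} (G : SimpleGraph V) (r : ℕ) (F : Finset (Finset V)) : Prop :=
  ∃ u v : V, G.Adj u v ∧ ∀ s ∈ F, G.IsNClique r s ∧ u ∈ s ∧ v ∈ s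

/-- `js_r(G)`: the maximum size of an `r`-joint of the finite graph `G` (`0` if `G` has no
edge). -/
noncomputable def jointSize {V : Type*} [Fintype V] (G : SimpleGraph V) (r : ℕ) : ℕ :=
  sSup {t : ℕ | ∃ F : Finset (Finset V), G.IsJoint r F ∧ F.card = t}

/-- The sizes of the joints of a finite graph are bounded, so `jointSize` is a maximum. -/
theorem bddAbove_jointSize {V : Type*} [Fintype V] (G : SimpleGraph V) (r : ℕ) :
    BddAbove {t : ℕ | ∃ F : Finset (Finset V), G.IsJoint r F ∧ F.card = t} :=
  ⟨Fintype.card (Finset V), by rintro _ ⟨F, -, rfl⟩; exact F.card_le_univ⟩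

end SimpleGraph

namespace SimpleGraph

open Finset Matrix

/-! The idea is to localise and then count. Among nonempty vertex sets, let S maximise q(G[S])/|S| +
γ log(|S|+1). Since q(H) ≤ 2|H| for every H, S contains a fixed proportion of the vertices. Deleting
a vertex of S does not raise the functional, so the smallest entry of the top eigenvector of G[S] is
close to the average (`le_qIndex_induce_compl_mul`). This forces every degree to be at least about
q/2, hence at least (1 - 1/k - ε)|S| (`half_qIndex_sub_le_degree`).

If G[S] contains K_{k+1}, averaging over that clique gives an edge with many common neighbours, and
greedy extension gives order n^(k-1) cliques on that edge (`pow_le_jointSize`).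

Otherwise the Andrásfai–Erdős–Sós theorem makes G[S] k-partite, which is contradictory. If S is
proper, then q(G[S])/|S| ≤ 2(1 - 1/k), while q(T_{n,k})/n is at most 2k/n² below this value; the
logarithm favours the whole graph by at least γ/(n+1), so S cannot be a maximiser. If S is
everything, G is itself k-partite. The Q-index m + b of a complete multipartite graph with classes
n_i solves Σ n_i/(b + 2 n_i) = 1, and concavity of y/(b + 2y) leaves only the Turán graph
(`nonempty_iso_turanGraph_of_qIndex_le`). -/

theorem sum_comp_le_sum_of_injective {V W : Type*} [Fintype V] [Fintype W] {f : W → V}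
    (hf : Function.Injective f) {g : V → ℝ} (hg : ∀ v, 0 ≤ g v) : ∑ w, g (f w) ≤ ∑ v, g v := by
  classical
  calc ∑ w, g (f w) = ∑ v ∈ univ.image f, g v := (Finset.sum_image hf.injOn).symm
    _ ≤ ∑ v, g v := Finset.sum_le_sum_of_subset_of_nonneg (subset_univ _) fun _ _ _ => hg _

/-! ### Rayleigh quotients and nonnegative eigenvectors of the signless Laplacian. -/

section Spectral

variable {V : Type*} [Fintype V] (G : SimpleGraph V) [DecidableRel G.Adj]

/-- The quadratic form of the signless Laplacian: the sum of `(x u + x w) ^ 2` over the edges. -/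
noncomputable def qForm (x : V → ℝ) : ℝ :=
  (∑ u, ∑ w, if G.Adj u w then (x u + x w) ^ 2 else 0) / 2

theorem cast_degree_eq_sum (u : V) : (G.degree u : ℝ) = ∑ w, if G.Adj u w then 1 else 0 := by
  rw [← card_neighborFinset_eq_degree, neighborFinset_eq_filter, Finset.card_filter]
  push_cast
  rfl

theorem qForm_eq_sum_mul (x : V → ℝ) :
    G.qForm x = ∑ u, x u * ∑ w, if G.Adj u w then x u + x w else 0 := by
  have h1 : ∑ u, x u * ∑ w, (if G.Adj u w then x u + x w else 0)
      = ∑ u, ∑ w, if G.Adj u w then x u * (x u + x w) else 0 := by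
    simp only [Finset.mul_sum, mul_ite, mul_zero]
  have h2 : ∑ u, ∑ w, (if G.Adj u w then x u * (x u + x w) else 0)
      = ∑ u, ∑ w, if G.Adj u w then x w * (x u + x w) else 0 := by
    rw [Finset.sum_comm]
    refine Finset.sum_congr rfl fun u _ => Finset.sum_congr rfl fun w _ => ?_
    simp only [G.adj_comm w u, add_comm]
  have h3 : ∑ u, ∑ w, (if G.Adj u w then (x u + x w) ^ 2 else 0)
      = (∑ u, ∑ w, if G.Adj u w then x u * (x u + x w) else 0)
        + ∑ u, ∑ w, if G.Adj u w then x w * (x u + x w) else 0 := by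
    simp only [← Finset.sum_add_distrib]
    refine Finset.sum_congr rfl fun u _ => Finset.sum_congr rfl fun w _ => ?_
    split_ifs <;> ring
  rw [h1, qForm, h3, ← h2]
  ring

/-- Replaces Perron–Frobenius: the absolute value of a top eigenvector is again one. -/
theorem qForm_le_qForm_abs (x : V → ℝ) : G.qForm x ≤ G.qForm fun u => |x u| := by
  unfold qForm
  gcongr with u _ w _
  split_ifs
  · rw [sq_le_sq]
    exact (abs_add_le _ _).trans (le_abs_self _)
  · exact le_rfl

theorem qForm_le_of_hom {W : Type*} [Fintype W] {H : SimpleGraph W}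
    [DecidableRel H.Adj] (f : H →g G) (hf : Function.Injective f) (x : V → ℝ) :
    H.qForm (fun w => x (f w)) ≤ G.qForm x := by
  unfold qForm
  gcongr
  have hn : ∀ u w, (0 : ℝ) ≤ if G.Adj u w then (x u + x w) ^ 2 else 0 := fun u w => by
    split_ifs <;> positivity
  calc ∑ u, ∑ w, (if H.Adj u w then (x (f u) + x (f w)) ^ 2 else 0)
      ≤ ∑ u, ∑ w, if G.Adj (f u) (f w) then (x (f u) + x (f w)) ^ 2 else 0 := by
        gcongr with u _ w _
        by_cases h : H.Adj u w
        · rw [if_pos h, if_pos (f.map_adj h)]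
        · rw [if_neg h]; exact hn _ _
    _ ≤ ∑ u, ∑ w, if G.Adj (f u) w then (x (f u) + x w) ^ 2 else 0 := by
        gcongr with u _
        exact sum_comp_le_sum_of_injective hf (hn (f u))
    _ ≤ ∑ u, ∑ w, if G.Adj u w then (x u + x w) ^ 2 else 0 := by
        exact sum_comp_le_sum_of_injective (g := fun u => ∑ w, if G.Adj u w then _ else _) hf
          fun _ => Finset.sum_nonneg fun _ _ => hn _ _

theorem qForm_one : G.qForm (fun _ => 1) = 4 * #G.edgeFinset := by
  have h1 : ∑ u, ∑ w, (if G.Adj u w then ((1 : ℝ) + 1) ^ 2 else 0) = 4 * ∑ u, (G.degree u : ℝ) := by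
    simp only [cast_degree_eq_sum, Finset.mul_sum]
    refine Finset.sum_congr rfl fun u _ => Finset.sum_congr rfl fun w _ => ?_
    split_ifs <;> norm_num
  have h2 : ∑ u, (G.degree u : ℝ) = 2 * #G.edgeFinset := by
    exact_mod_cast G.sum_degrees_eq_twice_card_edges
  rw [qForm, h1, h2]
  ring

variable [DecidableEq V]

theorem signlessLapMatrix_mulVec (x : V → ℝ) (u : V) :
    (G.signlessLapMatrix *ᵥ x) u = ∑ w, if G.Adj u w then x u + x w else 0 := by
  have h1 : (G.degMatrix ℝ *ᵥ x) u = (G.degree u : ℝ) * x u := by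
    simp [degMatrix, mulVec_diagonal]
  have h2 : (G.adjMatrix ℝ *ᵥ x) u = ∑ w, if G.Adj u w then x w else 0 := by
    simp [mulVec, dotProduct, adjMatrix_apply]
  rw [signlessLapMatrix, add_mulVec, Pi.add_apply, h1, h2, cast_degree_eq_sum, Finset.sum_mul,
    ← Finset.sum_add_distrib]
  refine Finset.sum_congr rfl fun w _ => ?_
  split_ifs <;> ring

theorem dotProduct_signlessLapMatrix_mulVec (x : V → ℝ) :
    x ⬝ᵥ (G.signlessLapMatrix *ᵥ x) = G.qForm x := by
  rw [qForm_eq_sum_mul]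
  simp only [dotProduct, signlessLapMatrix_mulVec]

theorem posSemidef_qIndex_smul_one_sub [Nonempty V] :
    (G.qIndex • (1 : Matrix V V ℝ) - G.signlessLapMatrix).PosSemidef := by
  rw [posSemidef_iff_isHermitian_and_spectrum_nonneg]
  refine ⟨?_, ?_⟩
  · refine IsHermitian.sub ?_ G.isHermitian_signlessLapMatrix
    ext i j
    simp [Matrix.one_apply, eq_comm]
  · intro r hr
    rw [← Algebra.algebraMap_eq_smul_one, ← spectrum.singleton_sub_eq] at hr
    obtain ⟨a, ha, b, hb, rfl⟩ := hr
    rw [Set.mem_singleton_iff] at ha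
    subst ha
    simpa using G.isGreatest_qIndex.2 hb

theorem dotProduct_qIndex_sub (x : V → ℝ) :
    x ⬝ᵥ ((G.qIndex • (1 : Matrix V V ℝ) - G.signlessLapMatrix) *ᵥ x)
      = G.qIndex * ∑ u, x u ^ 2 - G.qForm x := by
  rw [sub_mulVec, dotProduct_sub, dotProduct_signlessLapMatrix_mulVec, smul_mulVec, one_mulVec,
    dotProduct_smul]
  simp [dotProduct, pow_two]

theorem qForm_le [Nonempty V] (x : V → ℝ) : G.qForm x ≤ G.qIndex * ∑ u, x u ^ 2 := by
  have h := G.posSemidef_qIndex_smul_one_sub.dotProduct_mulVec_nonneg x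
  rw [star_trivial, dotProduct_qIndex_sub] at h
  linarith

/-- A nonnegative unit eigenvector for the `Q`-index. -/
theorem exists_nonneg_eigenvector [Nonempty V] :
    ∃ x : V → ℝ, (∀ u, 0 ≤ x u) ∧ ∑ u, x u ^ 2 = 1 ∧ G.qForm x = G.qIndex ∧
      ∀ u, (G.qIndex - G.degree u) * x u = ∑ w, if G.Adj u w then x w else 0 := by
  obtain ⟨y, hy0, hy⟩ : ∃ y ≠ 0, (G.qIndex • (1 : Matrix V V ℝ) - G.signlessLapMatrix) *ᵥ y = 0 := by
    rw [exists_mulVec_eq_zero_iff]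
    have h := G.isGreatest_qIndex.1
    rw [spectrum.mem_iff, Matrix.isUnit_iff_isUnit_det, isUnit_iff_ne_zero, not_not,
      Algebra.algebraMap_eq_smul_one] at h
    exact h
  have hyq : G.qForm y = G.qIndex * ∑ u, y u ^ 2 := by
    have h := G.dotProduct_qIndex_sub y
    rw [hy, dotProduct_zero] at h
    linarith
  have hpos : 0 < ∑ u, y u ^ 2 := by
    obtain ⟨u, hu⟩ := Function.ne_iff.1 hy0
    exact Finset.sum_pos' (fun _ _ => sq_nonneg _) ⟨u, mem_univ u, by simpa using sq_pos_of_ne_zero hu⟩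
  set s := ∑ u, y u ^ 2 with hs
  set x : V → ℝ := fun u => |y u| / √s with hx
  have hx1 : ∑ u, x u ^ 2 = 1 := by
    simp only [hx, div_pow, sq_abs, Real.sq_sqrt hpos.le]
    rw [← Finset.sum_div, ← hs, div_self hpos.ne']
  have hxq : G.qForm x = G.qIndex := by
    refine le_antisymm (by simpa [hx1] using G.qForm_le x) ?_
    have h1 : G.qForm x = G.qForm (fun u => |y u|) / s := by
      simp only [qForm, hx, ← add_div, div_pow, Real.sq_sqrt hpos.le]
      rw [div_right_comm]
      congr 1
      rw [Finset.sum_div]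
      refine Finset.sum_congr rfl fun u _ => ?_
      rw [Finset.sum_div]
      refine Finset.sum_congr rfl fun w _ => ?_
      split_ifs <;> simp
    rw [h1, le_div_iff₀ hpos, ← hyq]
    exact G.qForm_le_qForm_abs y
  refine ⟨x, fun u => by positivity, hx1, hxq, fun u => ?_⟩
  -- Equality in the Rayleigh bound puts `x` in the kernel of the positive semidefinite matrix qI -
  -- Q.
  have h0 := (G.posSemidef_qIndex_smul_one_sub.dotProduct_mulVec_zero_iff x).1 (by
    rw [star_trivial, dotProduct_qIndex_sub, hx1, hxq]; ring)
  have h := congrFun h0 u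
  rw [sub_mulVec, Pi.sub_apply, smul_mulVec, one_mulVec, signlessLapMatrix_mulVec] at h
  have h2 : ∑ w, (if G.Adj u w then x u + x w else 0)
      = G.degree u * x u + ∑ w, if G.Adj u w then x w else 0 := by
    rw [cast_degree_eq_sum, Finset.sum_mul, ← Finset.sum_add_distrib]
    refine Finset.sum_congr rfl fun w _ => ?_
    split_ifs <;> ring
  rw [h2] at h
  simp only [Pi.smul_apply, smul_eq_mul, Pi.zero_apply] at h
  linarith

theorem qIndex_le_of_qForm_le [Nonempty V] {q : ℝ}
    (h : ∀ x : V → ℝ, (∀ u, 0 ≤ x u) → ∑ u, x u ^ 2 = 1 → G.qForm x ≤ q) : G.qIndex ≤ q := by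
  obtain ⟨x, hx0, hx1, hxq, -⟩ := G.exists_nonneg_eigenvector
  exact hxq ▸ h x hx0 hx1

theorem qIndex_le_of_hom {W : Type*} [Fintype W] [DecidableEq W] [Nonempty W] {H : SimpleGraph W}
    [DecidableRel H.Adj] (f : H →g G) (hf : Function.Injective f) : H.qIndex ≤ G.qIndex := by
  have : Nonempty V := ⟨f (Classical.arbitrary W)⟩
  refine H.qIndex_le_of_qForm_le fun y _ hy1 => ?_
  set x : V → ℝ := Function.extend f y 0 with hx
  have hxy : (fun w => x (f w)) = y := by
    ext w
    exact hf.extend_apply y 0 w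
  have hx1 : ∑ u, x u ^ 2 = 1 := by
    rw [← hy1, ← hxy, ← Finset.sum_image (f := fun u => x u ^ 2) (s := univ) hf.injOn]
    refine (Finset.sum_subset (subset_univ _) fun u _ hu => ?_).symm
    have : ¬ ∃ w, f w = u := by simpa using hu
    simp [hx, Function.extend_apply' _ _ _ this]
  have h := G.qForm_le x
  rw [hx1, mul_one] at h
  refine le_trans ?_ h
  conv_lhs => rw [← hxy]
  exact G.qForm_le_of_hom f hf x

theorem qIndex_le_two_mul_card [Nonempty V] : G.qIndex ≤ 2 * Fintype.card V := by
  refine G.qIndex_le_of_qForm_le fun x _ hx1 => ?_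
  have h : ∑ u, ∑ w, (if G.Adj u w then (x u + x w) ^ 2 else 0)
      ≤ ∑ u, ∑ w, (2 * x u ^ 2 + 2 * x w ^ 2) := by
    gcongr with u _ w _
    split_ifs
    · nlinarith [sq_nonneg (x u - x w)]
    · positivity
  simp only [Finset.sum_add_distrib, Finset.sum_const, ← Finset.mul_sum, hx1, card_univ,
    nsmul_eq_mul] at h
  unfold qForm
  linarith

theorem four_mul_card_edgeFinset_le [Nonempty V] :
    4 * (#G.edgeFinset : ℝ) ≤ G.qIndex * Fintype.card V := by
  have h := G.qForm_le fun _ => 1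
  rw [qForm_one] at h
  simpa using h

end Spectral

/-! ### Vertex deletion and minimum degree. -/

/-- Here p = q/m and τ = m · (smallest entry)². The terms of order m cancel, leaving (p - 1)(1 - τ)
≤ γ + 2/m, so τ is close to 1. -/
theorem one_sub_le_of_deletion_bound {m γ p τ : ℝ} (hγ : 0 ≤ γ) (hm : 2 ≤ m) (hp : 5 / 4 ≤ p)
    (hp2 : p ≤ 2) (hτ0 : 0 ≤ τ) (hτ1 : τ ≤ 1)
    (h : p * m - 1 - (2 * (p * m) - m) * (τ / m) ≤ (p * m + γ) * (m - 1) / m * (1 - τ / m)) :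
    1 - τ ≤ 4 * (γ + 2 / m) := by
  have hm0 : 0 < m := by linarith
  have e1 : (p * m + γ) * (m - 1) / m * (1 - τ / m)
      = p * m - p - p * τ + p * τ / m + γ * ((1 - 1 / m) * (1 - τ / m)) := by
    field_simp
    ring
  have e2 : p * m - 1 - (2 * (p * m) - m) * (τ / m) = p * m - 1 - 2 * p * τ + τ := by
    field_simp
    ring
  have e3 : p * τ / m ≤ 2 / m := by
    gcongr
    nlinarith
  have e4 : (1 - 1 / m) * (1 - τ / m) ≤ 1 := by
    have h1 : 0 ≤ 1 / m := by positivity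
    have h2 : 0 ≤ τ / m := by positivity
    have h3 : τ / m ≤ 1 := by rw [div_le_one hm0]; linarith
    exact mul_le_one₀ (by linarith) (by linarith) (by linarith)
  have e5 := mul_le_of_le_one_right hγ e4
  rw [e1, e2] at h
  have h6 : (p - 1) * (1 - τ) ≤ γ + 2 / m := by linarith
  have h7 : 1 / 4 * (1 - τ) ≤ (p - 1) * (1 - τ) :=
    mul_le_mul_of_nonneg_right (by linarith) (by linarith)
  linarith

theorem half_sub_le_of_sq_bound {p e τ : ℝ} (hp : 5 / 4 ≤ p) (hτ : 1 / 2 ≤ τ) (hτ1 : τ ≤ 1)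
    (he : e ≤ 1) (h : (p ^ 2 - 2 * p * e) * τ ≤ e * (1 - τ)) : p / 2 - (1 - τ) ≤ e := by
  by_contra! hcon
  have h1 : 2 * p * (1 - τ) < p ^ 2 - 2 * p * e := by nlinarith
  have h2 : e * (1 - τ) ≤ 1 * (1 - τ) := mul_le_mul_of_nonneg_right he (by linarith)
  have h3 : 2 * p * (1 - τ) * τ < (p ^ 2 - 2 * p * e) * τ :=
    mul_lt_mul_of_pos_right h1 (by linarith)
  have h4 : 1 ≤ 2 * p * τ := by nlinarith
  have h5 : 1 * (1 - τ) ≤ 2 * p * τ * (1 - τ) := mul_le_mul_of_nonneg_right h4 (by linarith)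
  linarith

section VertexDeletion

variable {V : Type*} [Fintype V] (G : SimpleGraph V) [DecidableRel G.Adj]

variable {G} {x : V → ℝ}

/-- There are m - deg(u) non-neighbours, `u` included, and each carries mass at least `a`. -/
theorem sum_neighbors_sq_le {a : ℝ} (hx1 : ∑ u, x u ^ 2 = 1) (u : V) (ha : ∀ w, a ≤ x w ^ 2) :
    (∑ w, if G.Adj u w then x w ^ 2 else 0) ≤ 1 - (Fintype.card V - G.degree u) * a := by
  have h1 : (∑ w, if G.Adj u w then x w ^ 2 else 0) + ∑ w, (if G.Adj u w then 0 else a)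
      ≤ ∑ w, x w ^ 2 := by
    rw [← Finset.sum_add_distrib]
    refine Finset.sum_le_sum fun w _ => ?_
    split_ifs
    · simp
    · simpa using ha w
  have h2 : ∑ w, (if G.Adj u w then 0 else a) = (Fintype.card V - G.degree u) * a := by
    have : ∀ w, (if G.Adj u w then 0 else a) = a - (if G.Adj u w then 1 else 0) * a := fun w => by
      split_ifs <;> ring
    simp only [this, Finset.sum_sub_distrib, ← Finset.sum_mul, ← cast_degree_eq_sum]
    simp
    ring
  linarith

variable [DecidableEq V]

variable (G) in
theorem qForm_eq_add_qForm_induce_compl (v : V) (x : V → ℝ) :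
    G.qForm x = (∑ w, if G.Adj v w then (x v + x w) ^ 2 else 0) +
      (G.induce {w | w ≠ v}).qForm fun w => x w := by
  set F : V → V → ℝ := fun u w => if G.Adj u w then (x u + x w) ^ 2 else 0 with hF
  have hsymm : ∀ u w, F u w = F w u := fun u w => by
    simp only [hF, G.adj_comm u w, add_comm (x u)]
  have hvv : F v v = 0 := by simp [hF]
  have h1 : ∀ u, ∑ w, F u w = F u v + ∑ w : {w // w ≠ v}, F u w := fun u =>
    Fintype.sum_eq_add_sum_subtype_ne (F u) v
  have h2 : ∑ u, ∑ w, F u w = ∑ w, F v w + ∑ u : {w // w ≠ v}, ∑ w, F u w :=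
    Fintype.sum_eq_add_sum_subtype_ne (fun u => ∑ w, F u w) v
  have h3 : ∑ w : {w // w ≠ v}, F w v = ∑ w, F v w := by
    rw [h1 v, hvv, zero_add]
    exact Finset.sum_congr rfl fun _ _ => hsymm _ _
  have h4 : ∑ u : {w // w ≠ v}, ∑ w, F u w
      = ∑ u : {w // w ≠ v}, F u v + ∑ u : {w // w ≠ v}, ∑ w : {w // w ≠ v}, F u w := by
    rw [← Finset.sum_add_distrib]
    exact Finset.sum_congr rfl fun u _ => h1 u
  have h5 : (G.induce {w | w ≠ v}).qForm (fun w => x w)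
      = (∑ u : {w // w ≠ v}, ∑ w : {w // w ≠ v}, F u w) / 2 := rfl
  have h6 : G.qForm x = (∑ u, ∑ w, F u w) / 2 := rfl
  rw [h5, h6, h2, h4, h3]
  ring

/-- Deleting a vertex on which the eigenvector is smallest. -/
theorem le_qIndex_induce_compl_mul (hx1 : ∑ u, x u ^ 2 = 1) (hxq : G.qForm x = G.qIndex)
    (hxe : ∀ u, (G.qIndex - G.degree u) * x u = ∑ w, if G.Adj u w then x w else 0)
    {v : V} (hv : ∀ w, x v ^ 2 ≤ x w ^ 2) (hV : 2 ≤ Fintype.card V) :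
    G.qIndex - 1 - (2 * G.qIndex - Fintype.card V) * x v ^ 2
      ≤ (G.induce {w | w ≠ v}).qIndex * (1 - x v ^ 2) := by
  have : Nonempty {w // w ∈ {w | w ≠ v}} := by
    have : Nontrivial V := Fintype.one_lt_card_iff_nontrivial.1 hV
    obtain ⟨w, hw⟩ := exists_ne v
    exact ⟨⟨w, hw⟩⟩
  have h1 := (G.induce {w | w ≠ v}).qForm_le fun w => x w
  have h2 : ∑ w : {w // w ∈ {w | w ≠ v}}, x w ^ 2 = 1 - x v ^ 2 := by
    rw [← hx1, Fintype.sum_eq_add_sum_subtype_ne (fun u => x u ^ 2) v]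
    exact (add_sub_cancel_left _ _).symm
  have h3 := G.qForm_eq_add_qForm_induce_compl v x
  have h4 : (∑ w, if G.Adj v w then (x v + x w) ^ 2 else 0)
      = G.degree v * x v ^ 2 + 2 * x v * (∑ w, if G.Adj v w then x w else 0)
        + ∑ w, if G.Adj v w then x w ^ 2 else 0 := by
    rw [cast_degree_eq_sum, Finset.sum_mul, Finset.mul_sum, ← Finset.sum_add_distrib,
      ← Finset.sum_add_distrib]
    refine Finset.sum_congr rfl fun w _ => ?_
    split_ifs <;> ring
  have h5 := sum_neighbors_sq_le (G := G) hx1 v hv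
  rw [← hxe] at h4
  rw [h2] at h1
  rw [hxq, h4] at h3
  -- The degree d of `v` cancels: d + 2(q - d) - (m - d) = 2q - m.
  nlinarith

/-- If the smallest entry of the eigenvector is close to the average then all degrees are
at least about half the `Q`-index. -/
theorem qIndex_sq_sub_mul_le (hx0 : ∀ u, 0 ≤ x u) (hx1 : ∑ u, x u ^ 2 = 1)
    (hxe : ∀ u, (G.qIndex - G.degree u) * x u = ∑ w, if G.Adj u w then x w else 0)
    {v : V} (hv : ∀ w, x v ≤ x w) (u : V) :
    (G.qIndex ^ 2 - 2 * G.qIndex * G.degree u) * x v ^ 2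
      ≤ G.degree u * (1 - Fintype.card V * x v ^ 2) := by
  have hv2 : ∀ w, x v ^ 2 ≤ x w ^ 2 := fun w => pow_le_pow_left₀ (hx0 v) (hv w) 2
  have h1 := sum_neighbors_sq_le (G := G) hx1 u hv2
  have hd : (G.degree u : ℝ) ≤ Fintype.card V := by
    exact_mod_cast (G.degree_lt_card_verts u).le
  have hcs : (∑ w, if G.Adj u w then x w else 0) ^ 2
      ≤ G.degree u * ∑ w, if G.Adj u w then x w ^ 2 else 0 := by
    have := sq_sum_le_card_mul_sum_sq (s := G.neighborFinset u) (f := x)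
    rw [card_neighborFinset_eq_degree] at this
    simpa only [neighborFinset_eq_filter, Finset.sum_filter] using this
  rw [← hxe, mul_pow] at hcs
  have h2 : (G.qIndex - G.degree u) ^ 2 * x v ^ 2 ≤ (G.qIndex - G.degree u) ^ 2 * x u ^ 2 :=
    mul_le_mul_of_nonneg_left (hv2 u) (sq_nonneg _)
  -- With d the degree of `u`, the terms d² · x_v² on the two sides cancel, so the result is linear
  -- in d apart from the error factor.
  have h3 := mul_le_mul_of_nonneg_left h1 (Nat.cast_nonneg (α := ℝ) (G.degree u))
  nlinarith

/-- If no vertex deletion increases the `Q`-index relative to the order, all degrees are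
at least about half the `Q`-index. -/
theorem half_qIndex_sub_le_degree {γ : ℝ} (hγ : 0 ≤ γ) (hV : 2 ≤ Fintype.card V)
    (hq : 5 / 4 * (Fintype.card V : ℝ) ≤ G.qIndex)
    (hsmall : 4 * (γ + 2 / Fintype.card V) ≤ 1 / 2)
    (hdel : ∀ v, (G.induce {w | w ≠ v}).qIndex
      ≤ (G.qIndex + γ) * (Fintype.card V - 1) / Fintype.card V) (u : V) :
    G.qIndex / 2 - 4 * (γ + 2 / Fintype.card V) * Fintype.card V ≤ G.degree u := by
  have : Nonempty V := Fintype.card_pos_iff.1 (by omega)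
  obtain ⟨x, hx0, hx1, hxq, hxe⟩ := G.exists_nonneg_eigenvector
  obtain ⟨v, -, hv⟩ := Finset.exists_min_image univ x univ_nonempty
  replace hv : ∀ w, x v ≤ x w := fun w => hv w (mem_univ w)
  have hv2 : ∀ w, x v ^ 2 ≤ x w ^ 2 := fun w => pow_le_pow_left₀ (hx0 v) (hv w) 2
  have hA := le_qIndex_induce_compl_mul hx1 hxq hxe hv2 hV
  have hB := qIndex_sq_sub_mul_le hx0 hx1 hxe hv u
  have hdl := hdel v
  have hq2 := G.qIndex_le_two_mul_card
  have hd : (G.degree u : ℝ) ≤ Fintype.card V := by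
    exact_mod_cast (G.degree_lt_card_verts u).le
  have hm : (2 : ℝ) ≤ Fintype.card V := by exact_mod_cast hV
  have hmt : Fintype.card V * x v ^ 2 ≤ 1 := by
    rw [← hx1, ← nsmul_eq_mul]
    exact Finset.card_nsmul_le_sum univ (fun u => x u ^ 2) _ fun w _ => hv2 w
  generalize (Fintype.card V : ℝ) = m at *
  generalize G.qIndex = q at *
  generalize (G.degree u : ℝ) = d at *
  have hm0 : 0 < m := by linarith
  obtain ⟨p, rfl⟩ : ∃ p, q = p * m := ⟨q / m, by field_simp⟩
  obtain ⟨e, rfl⟩ : ∃ e, d = e * m := ⟨d / m, by field_simp⟩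
  obtain ⟨τ, hτ⟩ : ∃ τ, x v ^ 2 = τ / m := ⟨x v ^ 2 * m, by field_simp⟩
  have hτ0 : 0 ≤ τ := by
    have := sq_nonneg (x v)
    rw [hτ, le_div_iff₀ hm0] at this
    linarith
  rw [hτ] at hA hB hmt
  have hp : 5 / 4 ≤ p := le_of_mul_le_mul_right hq hm0
  have hp2 : p ≤ 2 := le_of_mul_le_mul_right hq2 hm0
  have he : e ≤ 1 := by
    refine le_of_mul_le_mul_right (?_ : e * m ≤ 1 * m) hm0
    rwa [one_mul]
  have hτ1 : τ ≤ 1 := by rwa [mul_div_cancel₀ _ hm0.ne'] at hmt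
  have ht1 : 0 ≤ 1 - τ / m := by
    have : τ / m ≤ 1 := by rw [div_le_one hm0]; linarith
    linarith
  have hC := hA.trans (mul_le_mul_of_nonneg_right hdl ht1)
  have hτ2 := one_sub_le_of_deletion_bound hγ hm hp hp2 hτ0 hτ1 hC
  have hD : (p ^ 2 - 2 * p * e) * τ ≤ e * (1 - τ) := by
    have e1 : ((p * m) ^ 2 - 2 * (p * m) * (e * m)) * (τ / m) = (p ^ 2 - 2 * p * e) * τ * m := by
      field_simp
    have e2 : e * m * (1 - m * (τ / m)) = e * (1 - τ) * m := by
      field_simp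
    rw [e1, e2] at hB
    exact le_of_mul_le_mul_right hB hm0
  have hE := half_sub_le_of_sq_bound hp (by linarith) hτ1 he hD
  have : (p / 2 - 4 * (γ + 2 / m)) * m ≤ e * m :=
    mul_le_mul_of_nonneg_right (by linarith) hm0.le
  linarith

end VertexDeletion

/-! ### The Q-index of complete multipartite graphs. -/

theorem qForm_mono {V : Type*} [Fintype V] {G H : SimpleGraph V} [DecidableRel G.Adj]
    [DecidableRel H.Adj] (h : G ≤ H) (x : V → ℝ) : G.qForm x ≤ H.qForm x :=
  H.qForm_le_of_hom (Hom.ofLE h) Function.injective_id x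

theorem le_comap_top_of_coloring {V ι : Type*} {G : SimpleGraph V} (C : G.Coloring ι) :
    G ≤ (⊤ : SimpleGraph ι).comap C := fun _ _ h => C.valid h

section Multipartite

variable {V ι : Type*} [Fintype V] [DecidableEq ι] (c : V → ι)

/-- The size of a colour class, as a real number. -/
noncomputable def classSize (i : ι) : ℝ := #{v | c v = i}

theorem classSize_nonneg (i : ι) : 0 ≤ classSize c i := Nat.cast_nonneg _

theorem sq_sum_class_le (x : V → ℝ) (i : ι) :
    (∑ u with c u = i, x u) ^ 2 ≤ classSize c i * ∑ u with c u = i, x u ^ 2 :=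
  sq_sum_le_card_mul_sum_sq

variable [Fintype ι]

theorem sum_classSize : ∑ i, classSize c i = Fintype.card V := by
  simp only [classSize, ← Nat.cast_sum]
  rw [← Finset.card_eq_sum_card_fiberwise (fun _ _ => mem_univ _), card_univ]

instance : DecidableRel ((⊤ : SimpleGraph ι).comap c).Adj :=
  inferInstanceAs (DecidableRel fun u w => (⊤ : SimpleGraph ι).Adj (c u) (c w))

theorem qForm_comap_top (x : V → ℝ) :
    ((⊤ : SimpleGraph ι).comap c).qForm x =
      ∑ i, (Fintype.card V - classSize c i) * ∑ u with c u = i, x u ^ 2 + (∑ u, x u) ^ 2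
        - ∑ i, (∑ u with c u = i, x u) ^ 2 := by
  have h1 : ∀ u, ∑ w, (if ((⊤ : SimpleGraph ι).comap c).Adj u w then x u + x w else 0)
      = (Fintype.card V - classSize c (c u)) * x u + ∑ w, x w - ∑ w with c w = c u, x w := by
    intro u
    have e : ∀ w, (if ((⊤ : SimpleGraph ι).comap c).Adj u w then x u + x w else 0)
        = x u + x w - if c w = c u then x u + x w else 0 := fun w => by
      by_cases h : c w = c u
      · simp [h]
      · simp [h, Ne.symm h]
    simp only [e, Finset.sum_sub_distrib, Finset.sum_add_distrib, ← Finset.sum_filter,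
      Finset.sum_const, nsmul_eq_mul, card_univ, classSize]
    ring
  rw [qForm_eq_sum_mul]
  simp only [h1]
  have h2 : ∀ u, x u * ((Fintype.card V - classSize c (c u)) * x u + ∑ w, x w
        - ∑ w with c w = c u, x w)
      = (Fintype.card V - classSize c (c u)) * x u ^ 2 + x u * ∑ w, x w
        - x u * ∑ w with c w = c u, x w := fun u => by ring
  simp only [h2, Finset.sum_sub_distrib, Finset.sum_add_distrib, ← Finset.sum_mul]
  rw [pow_two (∑ u, x u)]
  congr 1
  · congr 1
    rw [← Finset.sum_fiberwise univ c]
    refine Finset.sum_congr rfl fun i _ => ?_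
    rw [Finset.mul_sum]
    refine Finset.sum_congr rfl fun u hu => ?_
    rw [(mem_filter.1 hu).2]
  · rw [← Finset.sum_fiberwise univ c]
    refine Finset.sum_congr rfl fun i _ => ?_
    rw [pow_two, Finset.sum_mul]
    refine Finset.sum_congr rfl fun u hu => ?_
    rw [(mem_filter.1 hu).2]

/-- Cauchy–Schwarz inside each class and again across the classes. The sign of 1 - Σ n_i/(b + 2 n_i)
thus decides the comparison with m + b, and the subtracted term is kept for the equality case. -/
theorem qForm_comap_top_le {b : ℝ} (hb : 0 < b) (x : V → ℝ) :
    ((⊤ : SimpleGraph ι).comap c).qForm x ≤ (Fintype.card V + b) * ∑ u, x u ^ 2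
      - (1 - ∑ i, classSize c i / (b + 2 * classSize c i)) *
        ∑ i, (∑ u with c u = i, x u) ^ 2 * (b + 2 * classSize c i) / classSize c i := by
  have hcs : (∑ u, x u) ^ 2 ≤ (∑ i, classSize c i / (b + 2 * classSize c i)) *
      ∑ i, (∑ u with c u = i, x u) ^ 2 * (b + 2 * classSize c i) / classSize c i := by
    rw [← Finset.sum_fiberwise univ c]
    refine Finset.sum_sq_le_sum_mul_sum_of_sq_le_mul _ (fun i _ => ?_) (fun i _ => ?_)
      fun i _ => le_of_eq ?_
    · have := classSize_nonneg c i
      positivity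
    · have := classSize_nonneg c i
      positivity
    · have h0 := classSize_nonneg c i
      -- For an empty class the division by zero yields 0, and the class sum is 0 as well.
      rcases h0.eq_or_lt with h | h
      · have := sq_sum_class_le c x i
        rw [← h, zero_mul] at this
        rw [← h, zero_div, zero_mul]
        exact le_antisymm this (sq_nonneg _)
      · have : b + 2 * classSize c i ≠ 0 := by positivity
        field_simp
  have hterm : ∀ i, (Fintype.card V - classSize c i) * (∑ u with c u = i, x u ^ 2)
      + (∑ u with c u = i, x u) ^ 2 * (b + 2 * classSize c i) / classSize c i
      - (∑ u with c u = i, x u) ^ 2 ≤ (Fintype.card V + b) * ∑ u with c u = i, x u ^ 2 := by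
    intro i
    have h1 := sq_sum_class_le c x i
    have h0 := classSize_nonneg c i
    have hX : 0 ≤ ∑ u with c u = i, x u ^ 2 := Finset.sum_nonneg fun _ _ => sq_nonneg _
    set X := ∑ u with c u = i, x u ^ 2
    set s := ∑ u with c u = i, x u
    rcases h0.eq_or_lt with h | h
    · rw [← h]
      simp only [sub_zero, div_zero, add_zero]
      nlinarith [sq_nonneg s]
    · have h2 : s ^ 2 * (b + 2 * classSize c i) / classSize c i
          = s ^ 2 / classSize c i * (b + classSize c i) + s ^ 2 := by
        field_simp
        ring
      have h3 : s ^ 2 / classSize c i ≤ X := by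
        rw [div_le_iff₀ h]
        linarith
      rw [h2]
      nlinarith
  have hsum := Finset.sum_le_sum fun i (_ : i ∈ univ) => hterm i
  rw [Finset.sum_sub_distrib, Finset.sum_add_distrib, ← Finset.mul_sum,
    Finset.sum_fiberwise univ c (fun u => x u ^ 2)] at hsum
  rw [qForm_comap_top]
  linarith

/-- Converse to `qForm_comap_top_le`: writing A for the sum, the Rayleigh bound at a suitable test
vector reads A² ≤ A. -/
theorem sum_classSize_div_le_one [DecidableEq V] [Nonempty V] {b : ℝ} (hb : 0 < b)
    (hq : ((⊤ : SimpleGraph ι).comap c).qIndex ≤ Fintype.card V + b) :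
    ∑ i, classSize c i / (b + 2 * classSize c i) ≤ 1 := by
  set A := ∑ i, classSize c i / (b + 2 * classSize c i) with hA
  have hpos : ∀ i, 0 < b + 2 * classSize c i := fun i => by
    have := classSize_nonneg c i
    positivity
  have hA0 : 0 < A := by
    obtain ⟨v⟩ := ‹Nonempty V›
    refine Finset.sum_pos' (fun i _ => div_nonneg (classSize_nonneg c i) (hpos i).le)
      ⟨c v, mem_univ _, div_pos ?_ (hpos _)⟩
    exact Nat.cast_pos.2 (Finset.card_pos.2 ⟨v, by simp⟩)
  -- The eigenvalue equation on class i is (b + 2 n_i) x_i = Σ x, which dictates this vector.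
  set x : V → ℝ := fun u => 1 / (b + 2 * classSize c (c u)) with hx
  have h := ((⊤ : SimpleGraph ι).comap c).qForm_le x
  have hs1 : ∀ i, ∑ u with c u = i, x u = classSize c i / (b + 2 * classSize c i) := fun i => by
    rw [Finset.sum_congr rfl (g := fun _ => 1 / (b + 2 * classSize c i)) (by simp +contextual [hx]),
      Finset.sum_const, nsmul_eq_mul, classSize]
    ring
  have hs2 : ∀ i, ∑ u with c u = i, x u ^ 2
      = classSize c i / (b + 2 * classSize c i) ^ 2 := fun i => by
    rw [Finset.sum_congr rfl (g := fun _ => 1 / (b + 2 * classSize c i) ^ 2)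
      (by simp +contextual [hx]), Finset.sum_const, nsmul_eq_mul, classSize]
    ring
  have hS : ∑ u, x u = A := by
    rw [← Finset.sum_fiberwise univ c]
    exact Finset.sum_congr rfl fun i _ => hs1 i
  have hS2 : ∑ u, x u ^ 2 = ∑ i, classSize c i / (b + 2 * classSize c i) ^ 2 := by
    rw [← Finset.sum_fiberwise univ c]
    exact Finset.sum_congr rfl fun i _ => hs2 i
  rw [qForm_comap_top, hS] at h
  simp only [hs1, hs2] at h
  have hle : ((⊤ : SimpleGraph ι).comap c).qIndex * ∑ u, x u ^ 2
      ≤ (Fintype.card V + b) * ∑ i, classSize c i / (b + 2 * classSize c i) ^ 2 := by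
    rw [← hS2]
    exact mul_le_mul_of_nonneg_right hq (Finset.sum_nonneg fun _ _ => sq_nonneg _)
  have hid : (Fintype.card V + b) * ∑ i, classSize c i / (b + 2 * classSize c i) ^ 2
      = ∑ i, (Fintype.card V - classSize c i) * (classSize c i / (b + 2 * classSize c i) ^ 2)
        + A - ∑ i, (classSize c i / (b + 2 * classSize c i)) ^ 2 := by
    rw [hA, Finset.mul_sum, ← Finset.sum_add_distrib, ← Finset.sum_sub_distrib]
    refine Finset.sum_congr rfl fun i _ => ?_
    have := (hpos i).ne'
    field_simp
    ring
  have : A ^ 2 ≤ A := by linarith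
  nlinarith

/-- A `k`-partite graph on `m` vertices has `Q`-index at most `2 (1 - 1 / k) m`. -/
theorem qIndex_le_of_colorable [DecidableEq V] [Nonempty V] {G : SimpleGraph V}
    [DecidableRel G.Adj] {k : ℕ} (hk : 3 ≤ k) (hG : G.Colorable k) :
    G.qIndex ≤ 2 * (1 - 1 / k) * Fintype.card V := by
  obtain ⟨C⟩ := hG
  refine G.qIndex_le_of_qForm_le fun x _ hx1 => ?_
  have hk' : (3 : ℝ) ≤ k := by exact_mod_cast hk
  have hm : (0 : ℝ) < Fintype.card V := by exact_mod_cast Fintype.card_pos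
  have hsum := sum_classSize (C : V → Fin k)
  set m : ℝ := (Fintype.card V : ℝ) with hmdef
  have hb : 0 < (1 - 2 / k) * m := by
    have : 2 / (k : ℝ) < 1 := by rw [div_lt_one (by linarith)]; linarith
    exact mul_pos (by linarith) hm
  have h := qForm_comap_top_le (C : V → Fin k) hb x
  have h1 := (qForm_mono (le_comap_top_of_coloring C) x).trans h
  have hA : ∑ i, classSize C i / ((1 - 2 / k) * m + 2 * classSize C i) ≤ 1 := by
    -- Tangent line at y = m/k of the concave function y/(b + 2y) with b = (1 - 2/k)m, where the
    -- denominator equals m.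
    have : ∀ i, classSize C i / ((1 - 2 / k) * m + 2 * classSize C i)
        ≤ 1 / k + (1 - 2 / k) / m * (classSize C i - m / k) := fun i => by
      have h0 := classSize_nonneg (C : V → Fin k) i
      generalize classSize C i = y at *
      rw [div_le_iff₀ (by linarith)]
      have e : (1 / k + (1 - 2 / k) / m * (y - m / k)) * ((1 - 2 / k) * m + 2 * y)
          = y + 2 * (1 - 2 / k) / m * (y - m / k) ^ 2 := by
        field_simp
        ring
      have : 0 ≤ 2 * (1 - 2 / k) / m * (y - m / k) ^ 2 := by
        have : 0 < 1 - 2 / (k : ℝ) := by nlinarith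
        positivity
      linarith
    refine (Finset.sum_le_sum fun i _ => this i).trans ?_
    rw [Finset.sum_add_distrib, ← Finset.mul_sum, Finset.sum_sub_distrib, hsum]
    simp only [Finset.sum_const, card_univ, Fintype.card_fin, nsmul_eq_mul]
    have : (k : ℝ) ≠ 0 := by positivity
    field_simp
    simp
  rw [hx1] at h1
  have hR : 0 ≤ ∑ i, (∑ u with C u = i, x u) ^ 2 * ((1 - 2 / k) * m + 2 * classSize C i)
      / classSize C i := Finset.sum_nonneg fun i _ => by
    have := classSize_nonneg (C : V → Fin k) i
    positivity
  have e : m + (1 - 2 / k) * m = 2 * (1 - 1 / k) * m := by ring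
  nlinarith [mul_nonneg (sub_nonneg.2 hA) hR]

end Multipartite

/-! ### Concavity and balanced partitions. -/

/-- The concave function `y / (b + 2 y)` lies below its chord over `[a, a + 1]` at the integers. -/
theorem chord_sub_eq {b : ℝ} (hb : 0 < b) (a y : ℕ) :
    (a / (b + 2 * a) + (y - a) * (b / ((b + 2 * a) * (b + 2 * a + 2)))) - y / (b + 2 * y)
      = 2 * b * ((y - a) * (y - a - 1)) / ((b + 2 * a) * (b + 2 * a + 2) * (b + 2 * y)) := by
  have h1 : b + 2 * (a : ℝ) ≠ 0 := by positivity
  have h2 : b + 2 * (a : ℝ) + 2 ≠ 0 := by positivity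
  have h3 : b + 2 * (y : ℝ) ≠ 0 := by positivity
  field_simp
  ring

theorem sub_mul_sub_one_nonneg (a y : ℕ) : (0 : ℝ) ≤ (y - a) * (y - a - 1) := by
  rcases Nat.lt_or_ge a y with h | h
  · have : (a : ℝ) + 1 ≤ y := by exact_mod_cast h
    exact mul_nonneg (by linarith) (by linarith)
  · have : (y : ℝ) ≤ a := by exact_mod_cast h
    exact mul_nonneg_of_nonpos_of_nonpos (by linarith) (by linarith)

theorem div_le_chord {b : ℝ} (hb : 0 < b) (a y : ℕ) :
    y / (b + 2 * y) ≤ a / (b + 2 * a) + (y - a) * (b / ((b + 2 * a) * (b + 2 * a + 2))) := by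
  rw [← sub_nonneg, chord_sub_eq hb]
  have := sub_mul_sub_one_nonneg a y
  positivity

theorem eq_or_eq_of_chord_le {b : ℝ} (hb : 0 < b) {a y : ℕ}
    (h : a / (b + 2 * a) + (y - a) * (b / ((b + 2 * a) * (b + 2 * a + 2))) ≤ y / (b + 2 * y)) :
    y = a ∨ y = a + 1 := by
  rw [← sub_nonpos, chord_sub_eq hb] at h
  have h0 := sub_mul_sub_one_nonneg a y
  rcases h0.eq_or_lt with h1 | h1
  · rcases mul_eq_zero.1 h1.symm with h2 | h2
    · left
      exact_mod_cast sub_eq_zero.1 h2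
    · right
      rw [← @Nat.cast_inj ℝ]
      push_cast
      linarith
  · exact absurd h (not_le.2 (by positivity))

theorem div_eq_chord {b : ℝ} (hb : 0 < b) {a y : ℕ} (h : y = a ∨ y = a + 1) :
    y / (b + 2 * y) = a / (b + 2 * a) + (y - a) * (b / ((b + 2 * a) * (b + 2 * a + 2))) := by
  rw [eq_comm, ← sub_eq_zero, chord_sub_eq hb]
  rcases h with rfl | rfl <;> simp

section Balanced

variable {V : Type*} [Fintype V] {k : ℕ} (c : V → Fin k)

theorem two_mul_card_edgeFinset_comap_top :
    2 * (#((⊤ : SimpleGraph (Fin k)).comap c).edgeFinset : ℝ)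
      = (Fintype.card V : ℝ) ^ 2 - ∑ i, classSize c i ^ 2 := by
  classical
  have h := qForm_comap_top c fun _ => 1
  rw [qForm_one] at h
  have h1 : ∀ i, ∑ u with c u = i, (1 : ℝ) = classSize c i := fun i => by simp [classSize]
  simp only [one_pow, h1, sub_mul, Finset.sum_sub_distrib, ← Finset.mul_sum, sum_classSize] at h
  simp only [Finset.sum_const, card_univ, nsmul_eq_mul, mul_one, ← pow_two] at h
  linarith

variable {c}

/-- Both a and a + 1 are roots of (y - a)(y - a - 1), so y² is linear on the class sizes and the
number of larger classes need not be known. -/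
theorem sum_classSize_sq_of_balanced {a : ℕ}
    (ha : ∀ i, #{v | c v = i} = a ∨ #{v | c v = i} = a + 1) :
    ∑ i, classSize c i ^ 2 = (2 * a + 1) * Fintype.card V - k * (a * (a + 1)) := by
  have h : ∀ i, classSize c i ^ 2 = (2 * a + 1) * classSize c i - a * (a + 1) := fun i => by
    rcases ha i with h | h <;> rw [classSize, h] <;> push_cast <;> ring
  rw [Finset.sum_congr rfl fun i _ => h i, Finset.sum_sub_distrib, ← Finset.mul_sum, sum_classSize]
  simp

theorem sum_classSize_div_of_balanced {a : ℕ}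
    (ha : ∀ i, #{v | c v = i} = a ∨ #{v | c v = i} = a + 1) {b : ℝ} (hb : 0 < b) :
    ∑ i, classSize c i / (b + 2 * classSize c i) = k * (a / (b + 2 * a))
      + (Fintype.card V - k * a) * (b / ((b + 2 * a) * (b + 2 * a + 2))) := by
  have h : ∀ i, classSize c i / (b + 2 * classSize c i) = a / (b + 2 * a)
      + (classSize c i - a) * (b / ((b + 2 * a) * (b + 2 * a + 2))) := fun i =>
    div_eq_chord hb (ha i)
  rw [Finset.sum_congr rfl fun i _ => h i, Finset.sum_add_distrib,
    ← Finset.sum_mul, Finset.sum_sub_distrib, sum_classSize]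
  simp

end Balanced

/-- The left side of `h` is the sum of the chord values, which bound the summands from above; hence
equality holds in every class. -/
theorem balanced_of_le_sum_classSize_div {V : Type*} [Fintype V] {k : ℕ} (c : V → Fin k) {b : ℝ}
    (hb : 0 < b) (a : ℕ) (h : k * (a / (b + 2 * a))
      + (Fintype.card V - k * a) * (b / ((b + 2 * a) * (b + 2 * a + 2)))
        ≤ ∑ i, classSize c i / (b + 2 * classSize c i)) (i : Fin k) :
    #{v | c v = i} = a ∨ #{v | c v = i} = a + 1 := by
  have h1 : k * (a / (b + 2 * a)) + (Fintype.card V - k * a) * (b / ((b + 2 * a) * (b + 2 * a + 2)))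
      = ∑ i, (a / (b + 2 * a)
        + (classSize c i - a) * (b / ((b + 2 * a) * (b + 2 * a + 2)))) := by
    rw [Finset.sum_add_distrib, ← Finset.sum_mul, Finset.sum_sub_distrib, sum_classSize]
    simp
  rw [h1] at h
  have h2 := (Finset.sum_eq_sum_iff_of_le fun i _ => div_le_chord hb a #{v | c v = i}).1
    (le_antisymm (Finset.sum_le_sum fun i _ => div_le_chord hb a #{v | c v = i}) h)
  exact eq_or_eq_of_chord_le hb (h2 i (mem_univ i)).ge

/-! ### The Turán graph and its uniqueness among k-partite graphs. -/

section Turan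

/-- The colouring of the Turán graph. -/
def turanColor (n : ℕ) {k : ℕ} (hk : 0 < k) (v : Fin n) : Fin k := ⟨v % k, Nat.mod_lt _ hk⟩

theorem turanGraph_eq_comap {n k : ℕ} (hk : 0 < k) :
    turanGraph n k = (⊤ : SimpleGraph (Fin k)).comap (turanColor n hk) := by
  ext u w
  simp [turanGraph_adj, turanColor]

theorem card_turanColor {n k : ℕ} (hk : 0 < k) (i : Fin k) :
    #{v | turanColor n hk v = i} = n / k ∨ #{v | turanColor n hk v = i} = n / k + 1 := by
  have h : #{v | turanColor n hk v = i} = n.count (· ≡ i [MOD k]) := by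
    rw [Nat.count_eq_card_filter_range, Finset.card_filter, Finset.card_filter,
      ← Fin.sum_univ_eq_sum_range (fun v => if v ≡ i [MOD k] then 1 else 0)]
    refine Finset.sum_congr rfl fun v _ => ?_
    simp [turanColor, Fin.ext_iff, Nat.ModEq, Nat.mod_eq_of_lt i.2]
  rw [h, Nat.count_modEq_card _ hk]
  split_ifs <;> simp

theorem card_edgeFinset_turanGraph_eq {n k : ℕ} (hk : 0 < k) :
    2 * (#(turanGraph n k).edgeFinset : ℝ)
      = (n : ℝ) ^ 2 - ((2 * (n / k : ℕ) + 1) * n - k * ((n / k : ℕ) * ((n / k : ℕ) + 1))) := by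
  have h := two_mul_card_edgeFinset_comap_top (turanColor n hk)
  rw [sum_classSize_sq_of_balanced (card_turanColor hk), Fintype.card_fin] at h
  rw [← h]
  congr! 4
  exact turanGraph_eq_comap hk

/-- All-ones test vector. With r = n mod k the edge count is r(k - r)/(2k) below (1 - 1/k)n²/2, so
the loss is bounded independently of n; the logarithmic correction relies on this. -/
theorem le_qIndex_turanGraph_mul {n k : ℕ} (hk : 0 < k) (hn : 0 < n) :
    2 * (1 - 1 / k) * (n : ℝ) ^ 2 - 2 * k ≤ (turanGraph n k).qIndex * n := by
  have : Nonempty (Fin n) := ⟨⟨0, hn⟩⟩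
  have h := (turanGraph n k).four_mul_card_edgeFinset_le
  rw [Fintype.card_fin] at h
  refine le_trans ?_ h
  have h1 := card_edgeFinset_turanGraph_eq (n := n) hk
  have h2 : (n : ℝ) = k * (n / k : ℕ) + (n % k : ℕ) := by exact_mod_cast (Nat.div_add_mod n k).symm
  have h3 : ((n % k : ℕ) : ℝ) ≤ k := by exact_mod_cast (Nat.mod_lt n hk).le
  have hk' : (0 : ℝ) < k := by exact_mod_cast hk
  generalize ((n / k : ℕ) : ℝ) = a at *
  have h4 : 0 ≤ ((n % k : ℕ) : ℝ) := Nat.cast_nonneg _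
  generalize ((n % k : ℕ) : ℝ) = r at *
  rw [h2] at h1 ⊢
  have e : 2 * (1 - 1 / k) * (k * a + r) ^ 2 - 2 * k
      = 2 * ((k * a + r) ^ 2 - ((2 * a + 1) * (k * a + r) - k * (a * (a + 1))))
        - 2 * (k - r) - 2 * (r ^ 2 / k) := by
    field_simp
    ring
  have : 0 ≤ r ^ 2 / k := by positivity
  rw [e]
  linarith

end Turan

/-- When degrees exceed half the order, a nonnegative eigenvector is positive. -/
theorem pos_of_card_lt_two_mul_degree {V : Type*} [Fintype V] [DecidableEq V] {G : SimpleGraph V}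
    [DecidableRel G.Adj] (hdeg : ∀ u, Fintype.card V < 2 * G.degree u) {x : V → ℝ} {q : ℝ}
    (hx0 : ∀ u, 0 ≤ x u) (hx1 : ∑ u, x u ^ 2 = 1)
    (hxe : ∀ u, (q - G.degree u) * x u = ∑ w, if G.Adj u w then x w else 0) (u : V) : 0 < x u := by
  have hz : ∀ u w, G.Adj u w → x u = 0 → x w = 0 := by
    intro u w huw hu
    have h := hxe u
    rw [hu, mul_zero, eq_comm, Finset.sum_eq_zero_iff_of_nonneg
      (fun w _ => by split_ifs <;> simp [hx0])] at h
    simpa [huw] using h w (mem_univ w)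
  refine (hx0 u).lt_of_ne' fun hu => ?_
  have hall : ∀ w, x w = 0 := by
    intro w
    obtain ⟨z, hz'⟩ : (G.neighborFinset u ∩ G.neighborFinset w).Nonempty := by
      rw [← Finset.card_pos]
      have h1 := Finset.card_union_add_card_inter (G.neighborFinset u) (G.neighborFinset w)
      have h2 := Finset.card_le_univ (G.neighborFinset u ∪ G.neighborFinset w)
      have h3 := hdeg u
      have h4 := hdeg w
      rw [← card_neighborFinset_eq_degree] at h3 h4
      omega
    rw [mem_inter, mem_neighborFinset, mem_neighborFinset] at hz'
    exact hz z w hz'.2.symm (hz u z hz'.1 hu)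
  simp [hall] at hx1

/-- Among `k`-partite graphs of large minimum degree, only the Turán graph has the `Q`-index of
the Turán graph. -/
theorem nonempty_iso_turanGraph_of_qIndex_le {V : Type*} [Fintype V] [DecidableEq V] [Nonempty V]
    {G : SimpleGraph V} [DecidableRel G.Adj] {k : ℕ} (hk : 0 < k) (hG : G.Colorable k)
    (hdeg : ∀ u, Fintype.card V < 2 * G.degree u)
    (hT : Fintype.card V < (turanGraph (Fintype.card V) k).qIndex)
    (hq : (turanGraph (Fintype.card V) k).qIndex ≤ G.qIndex) :
    Nonempty (G ≃g turanGraph (Fintype.card V) k) := by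
  obtain ⟨C⟩ := id hG
  obtain ⟨x, hx0, hx1, hxq, hxe⟩ := G.exists_nonneg_eigenvector
  have hx := pos_of_card_lt_two_mul_degree hdeg hx0 hx1 hxe
  set n := Fintype.card V with hn
  have : Nonempty (Fin n) := ⟨⟨0, Fintype.card_pos⟩⟩
  obtain ⟨b, hb⟩ : ∃ b, b = (turanGraph n k).qIndex - n := ⟨_, rfl⟩
  have hb0 : 0 < b := by linarith
  have hTA : k * ((n / k : ℕ) / (b + 2 * (n / k : ℕ)))
      + (n - k * (n / k : ℕ)) * (b / ((b + 2 * (n / k : ℕ)) * (b + 2 * (n / k : ℕ) + 2))) ≤ 1 := by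
    have h1 := sum_classSize_div_le_one (turanColor n hk) hb0 (by
      rw [Fintype.card_fin, hb]
      refine le_of_eq ?_
      rw [add_sub_cancel]
      congr! 1
      exact (turanGraph_eq_comap hk).symm)
    rwa [sum_classSize_div_of_balanced (card_turanColor hk) hb0, Fintype.card_fin] at h1
  have hK := qForm_comap_top_le (C : V → Fin k) hb0 x
  rw [hx1, mul_one, ← hn, hb, add_sub_cancel, ← hb] at hK
  have hGK := le_comap_top_of_coloring C
  have hR : 0 < ∑ i, (∑ u with C u = i, x u) ^ 2 * (b + 2 * classSize C i) / classSize C i := by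
    obtain ⟨v⟩ := ‹Nonempty V›
    have hnn := classSize_nonneg (C : V → Fin k)
    refine Finset.sum_pos' (fun i _ => ?_) ⟨C v, mem_univ _, ?_⟩
    · have := hnn i
      positivity
    · have h1 : 0 < classSize C (C v) := Nat.cast_pos.2 (Finset.card_pos.2 ⟨v, by simp⟩)
      have h2 : 0 < ∑ u with C u = C v, x u := Finset.sum_pos (fun u _ => hx u) ⟨v, by simp⟩
      positivity
  have hmono := qForm_mono hGK x
  have hA : 1 ≤ ∑ i, classSize C i / (b + 2 * classSize C i) := by
    by_contra! hlt
    have := mul_pos (sub_pos.2 hlt) hR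
    linarith
  -- The sum over the Turán classes is at most 1, and the sum over the classes of `C` is at least 1.
  have hbal := balanced_of_le_sum_classSize_div C hb0 (n / k) (hTA.trans hA)
  have hA1 : ∑ i, classSize C i / (b + 2 * classSize C i) ≤ 1 := by
    rwa [sum_classSize_div_of_balanced hbal hb0]
  -- Both sums are now 1, so the multipartite form at `x` is at most q(T_{n,k}); since `x` is
  -- positive, a missing edge would make the form of `G` strictly smaller.
  have hGeq : G = (⊤ : SimpleGraph (Fin k)).comap C := by
    refine le_antisymm hGK fun u w huw => ?_
    by_contra hnot
    have hlt : G.qForm x < ((⊤ : SimpleGraph (Fin k)).comap C).qForm x := by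
      have hle : ∀ u w, (if G.Adj u w then (x u + x w) ^ 2 else 0)
          ≤ if ((⊤ : SimpleGraph (Fin k)).comap C).Adj u w then (x u + x w) ^ 2 else 0 := by
        intro u w
        by_cases h : G.Adj u w
        · rw [if_pos h, if_pos (hGK h)]
        · rw [if_neg h]
          split_ifs <;> positivity
      refine div_lt_div_of_pos_right (Finset.sum_lt_sum
        (fun u _ => Finset.sum_le_sum fun w _ => hle u w) ⟨u, mem_univ u, ?_⟩) two_pos
      refine Finset.sum_lt_sum (fun w _ => hle u w) ⟨w, mem_univ w, ?_⟩
      rw [if_neg hnot, if_pos huw]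
      have := hx u
      have := hx w
      positivity
    have := mul_nonneg (sub_nonneg.2 hA) hR.le
    have := mul_nonneg (sub_nonneg.2 hA1) hR.le
    nlinarith
  have hcard : #G.edgeFinset = #(turanGraph n k).edgeFinset := by
    have h1 := two_mul_card_edgeFinset_comap_top (C : V → Fin k)
    rw [sum_classSize_sq_of_balanced hbal, ← hn, ← card_edgeFinset_turanGraph_eq hk] at h1
    have h2 : #G.edgeFinset = #((⊤ : SimpleGraph (Fin k)).comap C).edgeFinset := by
      congr! 2
    rw [h2]
    exact_mod_cast mul_left_cancel₀ two_ne_zero h1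
  -- `G` is K_{k+1}-free with the Turán number of edges, so the isomorphism follows from uniqueness
  -- in Turán's theorem.
  rw [← isTuranMaximal_iff_nonempty_iso_turanGraph hk]
  obtain ⟨H, hHdec, hH⟩ := exists_isTuranMaximal (V := V) hk
  obtain ⟨f⟩ := hH.nonempty_iso_turanGraph
  refine ⟨hG.cliqueFree (Nat.lt_succ_self k), fun H' _ hH' => ?_⟩
  rw [hcard, ← f.card_edgeFinset_eq]
  exact hH.2 hH'

/-! ### Counting cliques on an edge. -/

section Joints

variable {V : Type*} [Fintype V] [DecidableEq V] (G : SimpleGraph V) [DecidableRel G.Adj]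

/-- The common neighbours of a set of vertices. -/
def commonNeighborFinset (s : Finset V) : Finset V := {w | ∀ u ∈ s, G.Adj u w}

/-- The cliques of order `r` that contain a given set. -/
def cliquesContaining (r : ℕ) (s : Finset V) : Finset (Finset V) := {t | G.IsNClique r t ∧ s ⊆ t}

/-- Double counting: a clique is counted once for each of its vertices in `A`, so at most r times.
-/
theorem sum_card_cliquesContaining_insert_le (r : ℕ) (s A : Finset V) :
    ∑ w ∈ A, #(G.cliquesContaining r (insert w s)) ≤ r * #(G.cliquesContaining r s) := by
  have h1 : ∀ w, #(G.cliquesContaining r (insert w s))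
      = ∑ t ∈ G.cliquesContaining r s, if w ∈ t then 1 else 0 := fun w => by
    rw [← Finset.card_filter]
    congr 1
    ext t
    simp only [cliquesContaining, mem_filter, mem_univ, true_and, Finset.insert_subset_iff]
    tauto
  simp only [h1]
  rw [Finset.sum_comm, mul_comm, ← smul_eq_mul]
  refine Finset.sum_le_card_nsmul _ _ _ fun t ht => ?_
  rw [← Finset.card_filter, ← (mem_filter.1 ht).2.1.card_eq]
  exact Finset.card_le_card fun w hw => (mem_filter.1 hw).2

theorem card_commonNeighborFinset_insert (s : Finset V) (w : V) :
    #(G.commonNeighborFinset s) + G.degree w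
      ≤ #(G.commonNeighborFinset (insert w s)) + Fintype.card V := by
  have h : G.commonNeighborFinset (insert w s) = G.commonNeighborFinset s ∩ G.neighborFinset w := by
    ext v
    simp [commonNeighborFinset, and_comm]
  rw [h, ← card_neighborFinset_eq_degree, ← Finset.card_union_add_card_inter, add_comm]
  gcongr
  exact Finset.card_le_univ _

/-- Greedy extension of a clique in a graph of large minimum degree. -/
theorem pow_le_card_cliquesContaining {B D : ℝ} (hB : 0 ≤ B) (hD : 0 ≤ D)
    (hdeg : ∀ u, Fintype.card V - D ≤ G.degree u) {r : ℕ} (hr : 0 < r) (j : ℕ) :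
    ∀ s : Finset V, G.IsClique s → #s + j = r → B + j * D ≤ #(G.commonNeighborFinset s) + D →
      (B / r) ^ j ≤ #(G.cliquesContaining r s) := by
  induction j with
  | zero =>
    intro s hs hsr _
    rw [pow_zero, Nat.one_le_cast, Nat.one_le_iff_ne_zero, ← Nat.pos_iff_ne_zero, Finset.card_pos]
    exact ⟨s, by simp [cliquesContaining, isNClique_iff, hs, ← hsr]⟩
  | succ j ih =>
    -- Each added vertex costs at most D common neighbours, so the budget leaves at least B choices
    -- at every stage.
    intro s hs hsr hcn
    have hr' : (0 : ℝ) < r := by exact_mod_cast hr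
    push_cast at hcn
    have h1 : ∀ w ∈ G.commonNeighborFinset s,
        (B / r) ^ j ≤ #(G.cliquesContaining r (insert w s)) := by
      intro w hw
      have hadj : ∀ u ∈ s, G.Adj u w := by simpa [commonNeighborFinset] using hw
      have hws : w ∉ s := fun h => G.irrefl (hadj w h)
      refine ih _ ?_ ?_ ?_
      · rw [coe_insert]
        exact hs.insert fun u hu _ => (hadj u hu).symm
      · rw [card_insert_of_notMem hws]
        omega
      · have h2 : (#(G.commonNeighborFinset s) : ℝ) + G.degree w
            ≤ #(G.commonNeighborFinset (insert w s)) + Fintype.card V := by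
          exact_mod_cast G.card_commonNeighborFinset_insert s w
        have h3 := hdeg w
        linarith
    have h2 := Finset.card_nsmul_le_sum _ _ _ h1
    rw [nsmul_eq_mul] at h2
    have h3 : ∑ w ∈ G.commonNeighborFinset s, (#(G.cliquesContaining r (insert w s)) : ℝ)
        ≤ r * #(G.cliquesContaining r s) := by
      exact_mod_cast G.sum_card_cliquesContaining_insert_le r s _
    have h4 : B ≤ #(G.commonNeighborFinset s) := by nlinarith [Nat.cast_nonneg (α := ℝ) j]
    have h5 : B * (B / r) ^ j ≤ #(G.commonNeighborFinset s) * (B / r) ^ j := by gcongr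
    rw [pow_succ, mul_comm, div_mul_eq_mul_div, div_le_iff₀ hr', mul_comm _ (r : ℝ)]
    linarith

/-- Averaging over a clique of order `k + 1` gives an edge with many common neighbours. -/
theorem exists_adj_card_commonNeighborFinset {D : ℝ}
    (hdeg : ∀ u, Fintype.card V - D ≤ G.degree u) {k : ℕ} (hk : 1 ≤ k) {U : Finset V}
    (hU : G.IsNClique (k + 1) U) :
    ∃ u v, G.Adj u v ∧ 2 * (k - 1) * (k + 1) * (Fintype.card V - D) - k * (k - 1) * Fintype.card V
      ≤ k * (k + 1) * (#(G.commonNeighborFinset {u, v}) : ℝ) := by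
  have hk' : (1 : ℝ) ≤ k := by exact_mod_cast hk
  set a : V → V → ℝ := fun u w => if G.Adj u w then 1 else 0 with ha
  have hcn : ∀ u v, (#(G.commonNeighborFinset {u, v}) : ℝ) = ∑ w, a u w * a v w := by
    intro u v
    rw [commonNeighborFinset, Finset.card_filter]
    push_cast
    refine Finset.sum_congr rfl fun w _ => ?_
    by_cases h1 : G.Adj u w <;> by_cases h2 : G.Adj v w <;> simp [ha, h1, h2]
  have hd : ∀ u, (G.degree u : ℝ) = ∑ w, a u w := fun u => G.cast_degree_eq_sum u
  have hint : ∀ w, ∃ d : ℤ, ∑ u ∈ U, a u w = d := fun w =>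
    ⟨#{u ∈ U | G.Adj u w}, by simp [ha]⟩
  -- Linear lower bound for d(d - 1), exact at the integers k - 1 and k. When degrees are near (1 -
  -- 1/k)m, the average of d is near k - 1/k, between these two.
  have hpt : ∀ w, 2 * (k - 1) * (∑ u ∈ U, a u w) - k * (k - 1)
      ≤ (∑ u ∈ U, a u w) * (∑ u ∈ U, a u w) - ∑ u ∈ U, a u w := by
    intro w
    obtain ⟨d, hd⟩ := hint w
    rw [hd]
    have h : 0 ≤ (d - k) * (d - k + 1) := by
      rcases le_or_gt (k : ℤ) d with h | h
      · exact mul_nonneg (by linarith) (by linarith)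
      · exact mul_nonneg_of_nonpos_of_nonpos (by linarith) (by linarith)
    have h' : (0 : ℝ) ≤ (d - k) * (d - k + 1) := by exact_mod_cast h
    nlinarith
  have hsum := Finset.sum_le_sum fun w (_ : w ∈ univ) => hpt w
  have hdU : (k + 1) * (Fintype.card V - D) ≤ ∑ w, ∑ u ∈ U, a u w := by
    rw [Finset.sum_comm]
    have := Finset.card_nsmul_le_sum U _ _ fun u _ => (hdeg u).trans (hd u).le
    rw [hU.card_eq, nsmul_eq_mul] at this
    exact_mod_cast this
  have hoff : ∑ w, ((∑ u ∈ U, a u w) * (∑ u ∈ U, a u w) - ∑ u ∈ U, a u w)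
      = ∑ p ∈ U.offDiag, (#(G.commonNeighborFinset {p.1, p.2}) : ℝ) := by
    simp only [hcn]
    rw [Finset.sum_comm]
    refine Finset.sum_congr rfl fun w _ => ?_
    rw [Finset.sum_mul_sum, ← Finset.sum_product', ← Finset.diag_union_offDiag,
      Finset.sum_union (Finset.disjoint_diag_offDiag _), Finset.sum_diag]
    have : ∀ u, a u w * a u w = a u w := fun u => by simp [ha]
    simp only [this]
    ring
  rw [hoff, Finset.sum_sub_distrib, ← Finset.mul_sum] at hsum
  simp only [Finset.sum_const, card_univ, nsmul_eq_mul] at hsum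
  have hoc : (#U.offDiag : ℝ) = k * (k + 1) := by
    rw [Finset.offDiag_card, hU.card_eq, Nat.cast_sub (Nat.le_mul_of_pos_left _ k.succ_pos)]
    push_cast
    ring
  by_contra! hcon
  have hlt := Finset.sum_lt_sum_of_nonempty (s := U.offDiag) (Finset.card_pos.1 (by
      rw [← @Nat.cast_pos ℝ, hoc]; positivity)) fun p hp => by
    obtain ⟨h1, h2, h3⟩ := Finset.mem_offDiag.1 hp
    exact hcon p.1 p.2 (hU.isClique h1 h2 h3)
  rw [← Finset.mul_sum, Finset.sum_const, nsmul_eq_mul, hoc] at hlt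
  have h1 := lt_of_mul_lt_mul_left hlt (by positivity)
  have h2 := mul_le_mul_of_nonneg_left hdU (by linarith : (0 : ℝ) ≤ 2 * (k - 1))
  linarith

theorem card_cliquesContaining_le_jointSize {u v : V} (huv : G.Adj u v) (r : ℕ) :
    #(G.cliquesContaining r {u, v}) ≤ G.jointSize r := by
  refine le_csSup (G.bddAbove_jointSize r) ⟨_, ⟨u, v, huv, fun s hs => ?_⟩, rfl⟩
  obtain ⟨h1, h2⟩ := (mem_filter.1 hs).2
  exact ⟨h1, h2 (by simp), h2 (by simp)⟩

/-- A graph of minimum degree close to `(1 - 1 / k) m` that contains `K_{k+1}` has a large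
`(k + 1)`-joint. -/
theorem pow_le_jointSize {k : ℕ} (hk : 2 ≤ k)
    (hdeg : ∀ u, (1 - 1 / k - 1 / (k ^ 3 * (k + 1))) * (Fintype.card V : ℝ) ≤ G.degree u)
    (hG : ¬ G.CliqueFree (k + 1)) :
    (Fintype.card V / (k ^ 2 * (k + 1) ^ 2) : ℝ) ^ (k - 1) ≤ G.jointSize (k + 1) := by
  rw [CliqueFree] at hG
  push Not at hG
  obtain ⟨U, hU⟩ := hG
  have hk' : (2 : ℝ) ≤ k := by exact_mod_cast hk
  set m : ℝ := (Fintype.card V : ℝ) with hm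
  have hm0 : 0 ≤ m := Nat.cast_nonneg _
  obtain ⟨D, hD⟩ : ∃ D, D = (1 / k + 1 / (k ^ 3 * (k + 1)) : ℝ) * m := ⟨_, rfl⟩
  have hdeg' : ∀ u, m - D ≤ G.degree u := fun u => by
    refine le_trans (le_of_eq ?_) (hdeg u)
    rw [hD]
    ring
  obtain ⟨u, v, huv, hcn⟩ := G.exists_adj_card_commonNeighborFinset hdeg' (by omega) hU
  rw [← hm] at hcn
  refine le_trans ?_ (Nat.cast_le.2 (G.card_cliquesContaining_le_jointSize huv (k + 1)))
  -- If D were m/k, the edge would have 2m/(k²(k+1)) common neighbours beyond the (k - 2)D used up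
  -- greedily. Half of this surplus is kept as B; the other half covers the excess of D over m/k.
  have hB : 0 ≤ m / (k ^ 2 * (k + 1)) := by positivity
  have key := G.pow_le_card_cliquesContaining hB (by rw [hD]; positivity) hdeg'
    (Nat.succ_pos k) (k - 1) {u, v}
    (by
      rw [coe_pair]
      exact (isClique_pair).2 fun _ => huv)
    (by
      rw [card_pair huv.ne]
      omega)
    (by
      rw [Nat.cast_sub (by omega), Nat.cast_one]
      generalize (#(G.commonNeighborFinset {u, v}) : ℝ) = c at *
      have hkk : (0 : ℝ) < k * (k + 1) := by positivity
      refine le_of_mul_le_mul_left ?_ hkk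
      have e : k * (k + 1) * (m / (k ^ 2 * (k + 1)) + (k - 1) * D)
          = 2 * (k - 1) * (k + 1) * (m - D) - k * (k - 1) * m + k * (k + 1) * D
            - 2 * m / k ^ 3 := by
        rw [hD]
        field_simp
        ring
      have : 0 ≤ 2 * m / k ^ 3 := by positivity
      rw [e]
      linarith)
  refine le_trans (le_of_eq ?_) key
  push_cast
  congr 1
  field_simp

end Joints

theorem jointSize_le_of_embedding {V W : Type*} [Fintype V] [Fintype W] {G : SimpleGraph V}
    {H : SimpleGraph W} (f : H ↪g G) (r : ℕ) : H.jointSize r ≤ G.jointSize r := by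
  classical
  by_cases hne : {t : ℕ | ∃ F : Finset (Finset W), H.IsJoint r F ∧ F.card = t}.Nonempty
  · refine csSup_le hne ?_
    rintro _ ⟨F, ⟨u, v, huv, hF⟩, rfl⟩
    refine le_csSup (G.bddAbove_jointSize r)
      ⟨F.map (Finset.mapEmbedding f.toEmbedding).toEmbedding,
        ⟨f u, f v, f.map_adj_iff.2 huv, fun s hs => ?_⟩, Finset.card_map _⟩
    obtain ⟨t, ht, rfl⟩ := Finset.mem_map.1 hs
    obtain ⟨h1, h2, h3⟩ := hF t ht
    refine ⟨?_, Finset.mem_map_of_mem f.toEmbedding h2, Finset.mem_map_of_mem f.toEmbedding h3⟩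
    exact (h1.map (f := f.toEmbedding)).mono (by
      rw [map_le_iff_le_comap]
      exact f.comap_eq.ge)
  · rw [Set.not_nonempty_iff_eq_empty] at hne
    rw [jointSize, hne]
    simp

theorem card_coe_finset {V : Type*} (S : Finset V) : Fintype.card (S : Set V) = #S := by simp

/-- Ensures b = q(T_{n,k}) - n > 0. As 2(1 - 1/k) ≥ 4/3, it suffices that n²/3 > 2k. -/
theorem card_lt_qIndex_turanGraph {n k : ℕ} (hk : 3 ≤ k) (hn : 6 * (k : ℝ) < n ^ 2) :
    (n : ℝ) < (turanGraph n k).qIndex := by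
  have hn0 : 0 < n := by
    rcases n.eq_zero_or_pos with rfl | h
    · have : (0 : ℝ) ≤ k := Nat.cast_nonneg _
      norm_num at hn
      linarith
    · exact h
  have hk' : (3 : ℝ) ≤ k := by exact_mod_cast hk
  have hinvk : 1 / (k : ℝ) ≤ 1 / 3 := by gcongr
  have h := le_qIndex_turanGraph_mul (n := n) (k := k) (by omega) hn0
  have h1 : 1 / (k : ℝ) * n ^ 2 ≤ 1 / 3 * n ^ 2 := by gcongr
  refine lt_of_mul_lt_mul_right (lt_of_lt_of_le ?_ h) (Nat.cast_nonneg n)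
  linarith

/-! ### The extremal induced subgraph and the conclusion. -/

section InducedSubgraph

variable {V : Type*} [Fintype V] [DecidableEq V] (G : SimpleGraph V) [DecidableRel G.Adj]

/-- The induced subgraph that maximizes the `Q`-index relative to the order, up to a logarithmic
correction. -/
theorem exists_induce_qIndex_induce_compl_le [Nonempty V] {γ : ℝ} (hγ : 0 ≤ γ) :
    ∃ S : Finset V, S.Nonempty ∧
      G.qIndex / Fintype.card V + γ * Real.log (Fintype.card V + 1)
        ≤ (G.induce (S : Set V)).qIndex / #S + γ * Real.log (#S + 1) ∧
      (2 ≤ #S → ∀ v : (S : Set V), ((G.induce (S : Set V)).induce {w | w ≠ v}).qIndex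
        ≤ ((G.induce (S : Set V)).qIndex + γ) * (#S - 1) / #S) := by
  obtain ⟨S, hS, hmax⟩ := Finset.exists_max_image ({S | S.Nonempty} : Finset (Finset V))
    (fun S => (G.induce (S : Set V)).qIndex / #S + γ * Real.log (#S + 1))
    ⟨univ, by simp⟩
  replace hS : S.Nonempty := by simpa using hS
  refine ⟨S, hS, ?_, fun h2 v => ?_⟩
  · refine le_trans ?_ (hmax univ (by simp))
    rw [card_univ]
    gcongr
    exact qIndex_le_of_hom _ (H := G) ⟨fun u => ⟨u, by simp⟩, fun h => h⟩
      fun u w h => congrArg Subtype.val h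
  · have hv : (v : V) ∈ S := v.2
    have hcard : #(S.erase v) + 1 = #S := Finset.card_erase_add_one hv
    have hne : (S.erase v).Nonempty := Finset.card_pos.1 (by omega)
    have h := hmax (S.erase v) (by simpa using hne)
    have hnt : Nonempty {w : (S : Set V) // w ∈ {w | w ≠ v}} := by
      obtain ⟨w, hw⟩ := hne
      exact ⟨⟨⟨w, Finset.mem_of_mem_erase hw⟩, fun e => Finset.ne_of_mem_erase hw (congrArg Subtype.val e)⟩⟩
    have hle : ((G.induce (S : Set V)).induce {w | w ≠ v}).qIndex
        ≤ (G.induce (S.erase v : Set V)).qIndex :=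
      qIndex_le_of_hom _
        ⟨fun u => ⟨u.1.1, Finset.mem_coe.2
          (Finset.mem_erase.2 ⟨fun e => u.2 (Subtype.ext e), u.1.2⟩)⟩, fun h => h⟩
        fun u w h => Subtype.ext (Subtype.ext (Subtype.mk.inj h))
    refine hle.trans ?_
    have hm : (#(S.erase v) : ℝ) = #S - 1 := by
      rw [← hcard]
      push_cast
      ring
    have hm2 : (2 : ℝ) ≤ #S := by exact_mod_cast h2
    rw [hm, sub_add_cancel] at h
    set m : ℝ := (#S : ℝ)
    -- Deleting a vertex lowers the logarithm by at most 1/m, which is the source of the `γ` added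
    -- to the Q-index.
    have hlog : Real.log (m + 1) ≤ Real.log m + 1 / m := by
      have h1 := Real.log_le_sub_one_of_pos (x := (m + 1) / m) (by positivity)
      rw [Real.log_div (by positivity) (by positivity)] at h1
      have h2 : (m + 1) / m - 1 = 1 / m := by field_simp; ring
      linarith
    have h3 := mul_le_mul_of_nonneg_left hlog hγ
    have h4 : (G.induce (S.erase v : Set V)).qIndex / (m - 1)
        ≤ ((G.induce (S : Set V)).qIndex + γ) / m := by
      rw [add_div]
      have : γ * (Real.log m + 1 / m) = γ * Real.log m + γ / m := by ring
      linarith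
    rw [div_le_iff₀ (by linarith)] at h4
    rw [mul_div_right_comm]
    exact h4

end InducedSubgraph

/-- Andrásfai–Erdős–Sós needs minimum degree above (3k - 4)m/(3k - 1). This threshold lies m/(k(3k -
1)) below (1 - 1/k)m, which exceeds the allowed deficit. -/
theorem colorable_of_cliqueFree_of_le_degree {V : Type*} [Fintype V] [Nonempty V]
    {G : SimpleGraph V} [DecidableRel G.Adj] {k : ℕ} (hk : 2 ≤ k) (hG : G.CliqueFree (k + 1))
    (hdeg : ∀ u, (1 - 1 / k - 1 / (k ^ 3 * (k + 1))) * (Fintype.card V : ℝ) ≤ G.degree u) :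
    G.Colorable k := by
  refine colorable_of_cliqueFree_lt_minDegree hG ?_
  obtain ⟨u, hu⟩ := G.exists_minimal_degree_vertex
  rw [hu, Nat.div_lt_iff_lt_mul (by omega)]
  have hk' : (2 : ℝ) ≤ k := by exact_mod_cast hk
  have hm : (0 : ℝ) < Fintype.card V := by exact_mod_cast Fintype.card_pos
  have h := hdeg u
  rw [← @Nat.cast_lt ℝ]
  push_cast [Nat.cast_sub (by omega : 4 ≤ 3 * k), Nat.cast_sub (by omega : 1 ≤ 3 * k)]
  have h1 : (3 * k - 4 : ℝ) < (1 - 1 / k - 1 / (k ^ 3 * (k + 1))) * (3 * k - 1) := by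
    have e : (1 - 1 / k - 1 / (k ^ 3 * (k + 1))) * (3 * k - 1)
        = (3 * k - 4 : ℝ) + (k ^ 2 * (k + 1) - (3 * k - 1)) / (k ^ 3 * (k + 1)) := by
      field_simp
      ring
    have : 0 < (k ^ 2 * (k + 1) - (3 * k - 1) : ℝ) := by nlinarith
    have : 0 < (k ^ 2 * (k + 1) - (3 * k - 1)) / (k ^ 3 * (k + 1) : ℝ) := by positivity
    linarith
  calc (3 * k - 4 : ℝ) * Fintype.card V
      < (1 - 1 / k - 1 / (k ^ 3 * (k + 1))) * (3 * k - 1) * Fintype.card V := by gcongr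
    _ = (1 - 1 / k - 1 / (k ^ 3 * (k + 1))) * Fintype.card V * (3 * k - 1) := by ring
    _ ≤ _ := mul_le_mul_of_nonneg_right h (by linarith)

/-- A graph with at least the `Q`-index of the Turán graph, and different from it, has an induced
subgraph of proportional order and large minimum degree that contains `K_{k+1}`. -/
theorem exists_induce_not_cliqueFree {k : ℕ} (hk : 3 ≤ k) {ε γ α : ℝ}
    (hε : ε = 1 / (k ^ 3 * (k + 1))) (hγ : γ = ε / 8) (hα : α = Real.exp (-(2 / γ)))
    {V : Type*} [Fintype V] [DecidableEq V] (G : SimpleGraph V) [DecidableRel G.Adj] {n : ℕ}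
    (hn : Fintype.card V = n) (hn1 : 64 / (ε * α) ≤ n) (hn2 : 4 * k / γ < n)
    (hq : (turanGraph n k).qIndex ≤ G.qIndex) (hiso : ¬ Nonempty (G ≃g turanGraph n k)) :
    ∃ S : Finset V, α / 2 * n ≤ #S ∧ ¬ (G.induce (S : Set V)).CliqueFree (k + 1) ∧
      ∀ u, (1 - 1 / k - 1 / (k ^ 3 * (k + 1))) * (#S : ℝ) ≤ (G.induce (S : Set V)).degree u := by
  have hk' : (3 : ℝ) ≤ k := by exact_mod_cast hk
  have hε0 : 0 < ε := by rw [hε]; positivity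
  have hε1 : ε ≤ 1 / 100 := by
    rw [hε]
    gcongr
    nlinarith [pow_le_pow_left₀ (by norm_num : (0 : ℝ) ≤ 3) hk' 3]
  have hγ0 : 0 < γ := by linarith
  have hα0 : 0 < α := by rw [hα]; positivity
  have hα1 : α ≤ 1 := by
    rw [hα, Real.exp_le_one_iff]
    have : 0 < 2 / γ := by positivity
    linarith
  have hnpos : (0 : ℝ) < n := lt_of_lt_of_le (by positivity) hn1
  have hn0 : 0 < n := by exact_mod_cast hnpos
  have hne : Nonempty V := Fintype.card_pos_iff.1 (hn ▸ hn0)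
  rw [div_le_iff₀ (by positivity)] at hn1
  rw [div_lt_iff₀ hγ0] at hn2
  have hn64 : 64 ≤ (n : ℝ) := by
    have : n * (ε * α) ≤ n * 1 := by
      gcongr
      exact mul_le_one₀ (by linarith) hα0.le hα1
    linarith
  have hT := le_qIndex_turanGraph_mul (n := n) (k := k) (by omega) hn0
  have hinvk : 1 / (k : ℝ) ≤ 1 / 3 := by gcongr
  have hkn : 2 * k / (n : ℝ) ^ 2 ≤ γ / (2 * n) := by
    rw [div_le_div_iff₀ (by positivity) (by positivity)]
    nlinarith
  have hkn' : γ / (2 * n) ≤ γ := by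
    rw [div_le_iff₀ (by positivity)]
    nlinarith
  have hp : 2 * (1 - 1 / k) - 2 * k / (n : ℝ) ^ 2 ≤ G.qIndex / n := by
    rw [le_div_iff₀ hnpos]
    refine le_trans ?_ hq
    rw [← mul_le_mul_iff_left₀ hnpos]
    refine le_trans (le_of_eq ?_) hT
    field_simp
  obtain ⟨S, hS, hΦ, hdel⟩ := G.exists_induce_qIndex_induce_compl_le hγ0.le
  have : Nonempty (S : Set V) := hS.to_subtype
  have hScard := card_coe_finset S
  rw [hn] at hΦ
  have hq2 := (G.induce (S : Set V)).qIndex_le_two_mul_card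
  rw [hScard] at hq2
  have hm0 : (0 : ℝ) < #S := by exact_mod_cast hS.card_pos
  have hmn : (#S : ℝ) ≤ n := by
    rw [← hn]
    exact_mod_cast S.card_le_univ
  have hlog : γ * (Real.log (n + 1) - Real.log (#S + 1)) ≤ 2 := by
    have h1 : (G.induce (S : Set V)).qIndex / #S ≤ 2 := by rwa [div_le_iff₀ hm0]
    have h2 : 0 ≤ G.qIndex / n := by linarith
    linarith
  -- Exponentiating gives |S| + 1 ≥ α(n + 1); halving α absorbs the added ones.
  have hSα : α / 2 * n ≤ #S := by
    have h1 : Real.log (n + 1) - 2 / γ ≤ Real.log (#S + 1) := by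
      have : 2 / γ * γ = 2 := by field_simp
      nlinarith
    rw [Real.le_log_iff_exp_le (by positivity), sub_eq_add_neg, Real.exp_add,
      Real.exp_log (by positivity), ← hα] at h1
    have h2 : n * (ε * α) ≤ n * α := by
      gcongr
      nlinarith
    nlinarith
  have hSbig : 32 / ε ≤ #S := by
    refine le_trans ?_ hSα
    rw [div_le_iff₀ hε0]
    linarith
  have hS8 : 8 / (#S : ℝ) ≤ ε / 4 := by
    rw [div_le_iff₀ hε0] at hSbig
    rw [div_le_iff₀ hm0]
    linarith
  have hS2 : 2 ≤ #S := by
    have : (2 : ℝ) ≤ #S := by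
      refine le_trans ?_ hSbig
      rw [le_div_iff₀ hε0]
      linarith
    exact_mod_cast this
  have hlogmono : Real.log (#S + 1) ≤ Real.log (n + 1) := by gcongr
  have hpS : 2 * (1 - 1 / k) - 2 * k / (n : ℝ) ^ 2 ≤ (G.induce (S : Set V)).qIndex / #S := by
    have := mul_le_mul_of_nonneg_left hlogmono hγ0.le
    linarith
  have h8 : 8 / (#S : ℝ) = 4 * (2 / #S) := by ring
  have hdeg : ∀ u, (1 - 1 / k - 1 / (k ^ 3 * (k + 1))) * (#S : ℝ)
      ≤ (G.induce (S : Set V)).degree u := by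
    intro u
    have h := half_qIndex_sub_le_degree (G := G.induce (S : Set V)) hγ0.le (by rwa [hScard])
      (by
        rw [hScard, ← le_div_iff₀ hm0]
        linarith)
      (by
        rw [hScard]
        linarith)
      (by
        rw [hScard]
        exact hdel hS2) u
    rw [hScard] at h
    refine le_trans ?_ h
    rw [le_div_iff₀ hm0] at hpS
    rw [← hε]
    -- The losses are k/n² ≤ ε/16, 4γ = ε/2 and 8/|S| ≤ ε/4, in total below ε.
    have h1 : (1 - 1 / k - ε) * (#S : ℝ) ≤ ((2 * (1 - 1 / k) - 2 * k / (n : ℝ) ^ 2) / 2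
        - 4 * (γ + 2 / #S)) * #S := by
      refine mul_le_mul_of_nonneg_right ?_ hm0.le
      linarith
    linarith
  refine ⟨S, hSα, fun hfree => ?_, hdeg⟩
  have hcol : (G.induce (S : Set V)).Colorable k :=
    colorable_of_cliqueFree_of_le_degree (by omega) hfree (by rwa [hScard])
  by_cases hSn : #S = n
  · have hSu : S = univ := Finset.eq_univ_of_card S (hSn.trans hn.symm)
    have hle : G.qIndex ≤ (G.induce (S : Set V)).qIndex :=
      qIndex_le_of_hom _ (H := G) ⟨fun u => ⟨u, by simp [hSu]⟩, fun h => h⟩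
        fun u w h => congrArg Subtype.val h
    have hnS : n = Fintype.card (S : Set V) := by rw [hScard, hSn]
    have h := nonempty_iso_turanGraph_of_qIndex_le (G := G.induce (S : Set V)) (k := k) (by omega)
      hcol
      (fun u => by
        rw [hScard]
        have h1 := hdeg u
        rw [← hε] at h1
        have h2 : 51 / 100 * (#S : ℝ) ≤ (1 - 1 / k - ε) * (#S : ℝ) := by
          refine mul_le_mul_of_nonneg_right ?_ hm0.le
          linarith
        have h3 : (#S : ℝ) < 2 * (G.induce (S : Set V)).degree u := by linarith
        exact_mod_cast h3)
      (by
        rw [← hnS]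
        refine card_lt_qIndex_turanGraph hk ?_
        have h1 : (n : ℝ) * γ ≤ n * (1 / 100) := by
          gcongr
          linarith
        have h2 : (n : ℝ) * 64 ≤ n * n := by gcongr
        linarith)
      (by
        rw [← hnS]
        exact hq.trans hle)
    rw [← hnS] at h
    obtain ⟨f⟩ := h
    exact hiso ⟨Iso.comp f ⟨⟨fun u => ⟨u, by simp [hSu]⟩, Subtype.val, fun _ => rfl, fun _ => rfl⟩,
      Iff.rfl⟩⟩
  · have hlt : (#S : ℝ) + 1 ≤ n := by
      have : #S ≤ n := by exact_mod_cast hmn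
      exact_mod_cast Nat.lt_of_le_of_ne this hSn
    have h1 := qIndex_le_of_colorable hk hcol
    rw [hScard, ← div_le_iff₀ hm0] at h1
    -- Since S is proper, the whole graph gains at least γ/(n+1) > γ/(2n) ≥ 2k/n² from the
    -- logarithm, more than the shortfall of q(G)/n from 2(1 - 1/k).
    have h2 : 1 / ((n : ℝ) + 1) ≤ Real.log (n + 1) - Real.log (#S + 1) := by
      rw [← Real.log_div (by positivity) (by positivity)]
      refine le_trans ?_ (Real.one_sub_inv_le_log_of_pos (by positivity))
      rw [inv_div, le_sub_iff_add_le, ← add_div, div_le_one (by positivity)]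
      linarith
    have h3 := mul_le_mul_of_nonneg_left h2 hγ0.le
    have h4 : γ / (2 * n) < γ * (1 / (n + 1)) := by
      rw [mul_one_div]
      gcongr
      linarith
    linarith

end SimpleGraph

theorem theorem2p9 (k : ℕ) (hk : 3 ≤ k) :
    ∃ c : ℝ, 0 < c ∧ ∃ n₀ : ℕ, ∀ n : ℕ, n₀ ≤ n →
      ∀ (V : Type*) [Fintype V] [DecidableEq V] (G : SimpleGraph V) [DecidableRel G.Adj],
        Fintype.card V = n →
        (SimpleGraph.turanGraph n k).qIndex ≤ G.qIndex →
        ¬ Nonempty (G ≃g SimpleGraph.turanGraph n k) →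
        c * (n : ℝ) ^ (k - 1) ≤ (G.jointSize (k + 1) : ℝ) := by
  obtain ⟨ε, hε⟩ : ∃ ε : ℝ, ε = 1 / (k ^ 3 * (k + 1)) := ⟨_, rfl⟩
  obtain ⟨γ, hγ⟩ : ∃ γ : ℝ, γ = ε / 8 := ⟨_, rfl⟩
  obtain ⟨α, hα⟩ : ∃ α : ℝ, α = Real.exp (-(2 / γ)) := ⟨_, rfl⟩
  have hα0 : 0 < α := by rw [hα]; positivity
  have hk0 : (0 : ℝ) < k := by exact_mod_cast (by omega : 0 < k)
  -- The factor α/2 is the guaranteed proportion |S|/n; the rest is the bound of `pow_le_jointSize`.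
  refine ⟨(α / 2 / (k ^ 2 * (k + 1) ^ 2)) ^ (k - 1), by positivity,
    max ⌈64 / (ε * α)⌉₊ (⌊4 * k / γ⌋₊ + 1), fun n hn V _ _ G _ hV hq hiso => ?_⟩
  obtain ⟨S, hS, hfree, hdeg⟩ := G.exists_induce_not_cliqueFree hk hε hγ hα hV
    (Nat.ceil_le.1 ((le_max_left _ _).trans hn))
    ((Nat.lt_floor_add_one _).trans_le (by exact_mod_cast (le_max_right _ _).trans hn)) hq hiso
  have h := (G.induce (S : Set V)).pow_le_jointSize (k := k) (by omega)
    (by rwa [SimpleGraph.card_coe_finset]) hfree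
  rw [SimpleGraph.card_coe_finset] at h
  calc (α / 2 / (k ^ 2 * (k + 1) ^ 2)) ^ (k - 1) * (n : ℝ) ^ (k - 1)
      = (α / 2 * n / (k ^ 2 * (k + 1) ^ 2)) ^ (k - 1) := by
        rw [← mul_pow, div_mul_eq_mul_div]
    _ ≤ ((S.card : ℝ) / (k ^ 2 * (k + 1) ^ 2)) ^ (k - 1) := by gcongr
    _ ≤ ((G.induce (S : Set V)).jointSize (k + 1) : ℝ) := h
    _ ≤ (G.jointSize (k + 1) : ℝ) := by
        exact_mod_cast SimpleGraph.jointSize_le_of_embedding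
          (SimpleGraph.Embedding.induce (S : Set V)) _
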